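/- Let $s=\begin{pmatrix}1&0\\0&-1\end{pmatrix}$ and $t=\frac14\begin{pmatrix}(1+\sqrt3)+(-1+\sqrt3)i & (1+\sqrt3)+(-1+\sqrt3)i\\ (-1+\sqrt3)-(1+\sqrt3)i & (1-\sqrt3)+(1+\sqrt3)i\end{pmatrix}$ in $GL_2(\mathbb C)$, let $G_4=\langle t, sts\rangle$ (the exceptional complex reflection group of order $24$), let $R_1$ be the conjugacy class of $t$ in $G_4$, and let $R_1^{-1}$ be the set of inverses of elements of $R_1$. A reflection is an element of $GL_2(\mathbb C)$ whose fixed space has dimension $1$. A reflection factorization of $g$ of length $l$ is a tuple $(r_1,\dots,r_l)$ of reflections with $r_1\cdots r_l=g$; it generates the group $\langle r_1,\dots,r_l\rangle$. A Hurwitz move replaces two consecutive entries $(r_i,r_{i+1})$ of a tuple by $(r_{i+1},\,r_{i+1}^{-1}r_ir_{i+1})$, and the Hurwitz orbit of a tuple is the set of all tuples obtained from it by finitely many Hurwitz moves. For $x\in R_1$, $y\in R_1^{-1}$ with $y\ne x^{-1}$, and integers $n,m\ge 0$ with $n+m\ge 8$ and $n+2m\equiv1\pmod 3$, define the standard factorization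 $[n,m]^x_{G_4}$ (with respect to the choice of $y$) as follows, where $a^{(k)}$ denotes $k$ consecutive entries equal to $a$ and all congruences are modulo $3$: 1. if $n\equiv2$ and $m\equiv1$: $\bigl(x^{(n-2)},x,y^{-1},y,y^{(m-1)}\bigr)$; 2. if $n\equiv1$, $m\equiv0$ and $m\ge3$: $\bigl(x^{(n)},y^{(m)}\bigr)$; 3. if $n\equiv1$ and $m=0$: $\bigl(x^{(n-4)},x,y^{-1},y^{-1},y^{-1}\bigr)$; 4. if $n\equiv0$, $m\equiv2$ and $m\ge5$: $\bigl(x^{(n)},x^{-1},x^{-1},y^{(m-2)}\bigr)$; 5. if $n\equiv0$ and $m=2$: $\bigl(x^{(n-3)},x^{-1},x^{-1},y^{-1},y^{-1},y^{-1}\bigr)$. **Proposition.** Let $x\in R_1$, and let $T$ be a reflection factorization of $x$ of length $l\ge8$ that generates $G_4$, with exactly $n$ entries in $R_1$ and $m$ entries in $R_1^{-1}$ (counted with multiplicity). Then $n+2m\equiv1\pmod3$; there exists $y\in R_1^{-1}$ with $y\neq x^{-1}$; and for every such $y$, the standard factorization $[n,m]^x_{G_4}$ belongs to the Hurwitz orbit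 of $T$, i.e. $T$ is Hurwitz equivalent to $[n,m]^x_{G_4}$. -/

import Mathlib

namespace TetrahedralReflection

/-- A reflection of a finite-dimensional complex vector space `V`: a linear map whose fixed space
(the eigenspace for the eigenvalue `1`) has dimension `dim V - 1`. -/
def IsReflection {V : Type*} [AddCommGroup V] [Module ℂ V] (f : V →ₗ[ℂ] V) : Prop :=
  Module.finrank ℂ (Module.End.eigenspace f (1 : ℂ)) + 1 = Module.finrank ℂ V

/-- `T = (r₁, …, r_k)` is a reflection factorization of `g`: every `r_i` is a reflection
of `ℂ²` and `r₁ ⋯ r_k = g`. -/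
structure IsReflectionFactorization (T : List (GL (Fin 2) ℂ)) (g : GL (Fin 2) ℂ) : Prop where
  isReflection : ∀ r ∈ T, IsReflection (Matrix.toLin' (r : Matrix (Fin 2) (Fin 2) ℂ))
  prod_eq : T.prod = g

/-- The matrix of the generator `s`. -/
def sMatrix : Matrix (Fin 2) (Fin 2) ℂ := !![1, 0; 0, -1]

/-- The matrix of the generator `t`. -/
noncomputable def tMatrix : Matrix (Fin 2) (Fin 2) ℂ :=
  (1 / 4 : ℂ) •
    !![(1 + (Real.sqrt 3 : ℂ)) + (-1 + (Real.sqrt 3 : ℂ)) * Complex.I,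
       (1 + (Real.sqrt 3 : ℂ)) + (-1 + (Real.sqrt 3 : ℂ)) * Complex.I;
       (-1 + (Real.sqrt 3 : ℂ)) - (1 + (Real.sqrt 3 : ℂ)) * Complex.I,
       (1 - (Real.sqrt 3 : ℂ)) + (1 + (Real.sqrt 3 : ℂ)) * Complex.I]

theorem sMatrix_det_ne_zero : sMatrix.det ≠ 0 := by
  simp [sMatrix, Matrix.det_fin_two]

theorem tMatrix_det : tMatrix.det = (-1 + (Real.sqrt 3 : ℂ) * Complex.I) / 2 := by
  have h3 : (Real.sqrt 3 : ℂ) ^ 2 = 3 := by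
    rw [← Complex.ofReal_pow, Real.sq_sqrt (by norm_num)]; norm_num
  have hI : Complex.I ^ 2 = -1 := Complex.I_sq
  simp only [tMatrix, Matrix.det_fin_two, Matrix.smul_apply, smul_eq_mul, Matrix.of_apply,
    Matrix.cons_val', Matrix.cons_val_zero, Matrix.cons_val_one, Matrix.cons_val_fin_one]
  generalize (Real.sqrt 3 : ℂ) = q at h3 ⊢
  generalize Complex.I = i at hI ⊢
  linear_combination (1 / 8 * i ^ 2 - 1 / 8) * h3 + 1 / 4 * hI

theorem tMatrix_det_ne_zero : tMatrix.det ≠ 0 := by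
  rw [tMatrix_det]
  intro h
  have := congrArg Complex.re h
  norm_num at this

/-- The reflection `s` of order two, as an element of `GL₂(ℂ)`. -/
noncomputable def s : GL (Fin 2) ℂ :=
  Matrix.GeneralLinearGroup.mkOfDetNeZero sMatrix sMatrix_det_ne_zero

/-- The reflection `t` of order three, as an element of `GL₂(ℂ)`. -/
noncomputable def t : GL (Fin 2) ℂ :=
  Matrix.GeneralLinearGroup.mkOfDetNeZero tMatrix tMatrix_det_ne_zero

/-- The complex reflection group `G₄ = ⟨t, s t s⟩`. -/
noncomputable def G4 : Subgroup (GL (Fin 2) ℂ) :=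
  Subgroup.closure {t, s * t * s}

/-- `R₁`, the conjugacy class of `t` in `G₄`. -/
def R1 : Set (GL (Fin 2) ℂ) := {g | ∃ h ∈ G4, g = h * t * h⁻¹}

/-- `R₁⁻¹`, the class of the inverses of the elements of `R₁`. -/
def R1Inv : Set (GL (Fin 2) ℂ) := {g | g⁻¹ ∈ R1}

section Hurwitz

variable {G : Type*} [Group G]

/-- `HurwitzMove T T'`: the tuple `T'` is obtained from `T` by a Hurwitz move
`(…, a, b, …) ↦ (…, b, b⁻¹ a b, …)` at some position. -/
inductive HurwitzMove : List G → List G → Prop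
  | move (l₁ l₂ : List G) (a b : G) :
      HurwitzMove (l₁ ++ a :: b :: l₂) (l₁ ++ b :: (b⁻¹ * a * b) :: l₂)

/-- The Hurwitz orbit of `T`: all tuples that are produced from `T` by finitely many
(possibly zero) Hurwitz moves. -/
def hurwitzOrbit (T : List G) : Set (List G) :=
  {T' | Relation.ReflTransGen HurwitzMove T T'}

open Classical in
/-- The number of entries of the tuple `T` that lie in `C`, counted with multiplicity. -/
noncomputable def classCount (C : Set G) (T : List G) : ℕ :=
  T.countP (fun r => r ∈ C)

/-- The standard factorization `[n, m]^x` of a reflection `x ∈ R₁`, written with the auxiliary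
element `y ∈ R₁⁻¹`, `y ≠ x⁻¹`. The five branches are the five cases of its definition; the
last line is a dummy value for pairs `(n, m)` that belong to none of them. -/
def standardFactorization (x y : G) (n m : ℕ) : List G :=
  if n % 3 = 2 ∧ m % 3 = 1 then
    List.replicate (n - 2) x ++ [x, y⁻¹, y] ++ List.replicate (m - 1) y
  else if n % 3 = 1 ∧ m % 3 = 0 ∧ 3 ≤ m then
    List.replicate n x ++ List.replicate m y
  else if n % 3 = 1 ∧ m = 0 then
    List.replicate (n - 4) x ++ [x, y⁻¹, y⁻¹, y⁻¹]
  else if n % 3 = 0 ∧ m % 3 = 2 ∧ 5 ≤ m then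
    List.replicate n x ++ [x⁻¹, x⁻¹] ++ List.replicate (m - 2) y
  else if n % 3 = 0 ∧ m = 2 then
    List.replicate (n - 3) x ++ [x⁻¹, x⁻¹, y⁻¹, y⁻¹, y⁻¹]
  else []

end Hurwitz

end TetrahedralReflection

/-! The eight reflections are labelled by a flag (class or inverse class) and one of four points, on
which conjugation acts as the alternating group. Tuples become words in these labels, and finite
questions are settled by exact computation in a model of the group over the Eisenstein integers.
Determinants give the congruence.

Two ideas carry the equivalence. First, a word `a a a` or `a a⁻¹` has trivial product, so it slides
past any letter `b`, either unchanged or conjugated by `b` (`IsBlock`). Inside a nondegenerate word,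
one whose letters do not all sit at one point, such a block can therefore be replaced by any block
of the same flag (`IsBlock.transport`). Secondly, any word of length at least 4 whose product is a
reflection of the first class is equivalent to one ending in a cube (`hasCube_of_wordProd_eq`).

Induction on length follows in `equiv_standardWord`: split off a cube, normalize the rest, and put
the cube back as `x³` in front or `y³` behind. When the rest is degenerate it consists of `x` and
`x⁻¹` only; then either a different block is split off, or the word is one of four short ones,
treated directly. -/

namespace TetrahedralReflection

/-! ### Labels of the reflections -/

/-- Labels of the eight reflections: a point of the projective line over `𝔽₃`, together with a
flag which is `true` for the inverses. -/
abbrev Letter := Bool × Fin 4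

namespace Letter

/-- The label of the inverse reflection. -/
def inv (a : Letter) : Letter := (!a.1, a.2)

/-- The label of `b⁻¹ a b`. -/
def conj (a b : Letter) : Letter :=
  (a.1, cond b.1
    ((![![0, 2, 3, 1], ![3, 1, 0, 2], ![1, 3, 2, 0], ![2, 0, 1, 3]] :
      Fin 4 → Fin 4 → Fin 4) a.2 b.2)
    ((![![0, 3, 1, 2], ![2, 1, 3, 0], ![3, 0, 2, 1], ![1, 2, 0, 3]] :
      Fin 4 → Fin 4 → Fin 4) a.2 b.2))

theorem conj_snd_of_eq : ∀ a b : Letter, a.2 = b.2 → (a.conj b).2 = b.2 := by decide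

end Letter

/-! ### Hurwitz moves on words -/

/-- `WordMove w w'`: the word `w'` is obtained from `w` by a Hurwitz move. -/
inductive WordMove : List Letter → List Letter → Prop
  | move (l₁ l₂ : List Letter) (a b : Letter) :
      WordMove (l₁ ++ a :: b :: l₂) (l₁ ++ b :: a.conj b :: l₂)

/-- Hurwitz equivalence of words. -/
def WordEquiv : List Letter → List Letter → Prop := Relation.ReflTransGen WordMove

/-- The Hurwitz move at a given position of a word (trivial if the position is out of range). -/
def moveAt : ℕ → List Letter → List Letter
  | 0, a :: b :: l => b :: a.conj b :: l
  | i + 1, a :: l => a :: moveAt i l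
  | _, l => l

/-- Whether the walk which starts at a word and performs moves at the given positions meets a
word that satisfies `p`. -/
def walkMeets (p : List Letter → Bool) : List ℕ → List Letter → Bool
  | [], w => p w
  | i :: s, w => p w || walkMeets p s (moveAt i w)

namespace WordEquiv

theorem refl (w : List Letter) : WordEquiv w w := Relation.ReflTransGen.refl

theorem trans {u v w : List Letter} (h : WordEquiv u v) (h' : WordEquiv v w) : WordEquiv u w :=
  Relation.ReflTransGen.trans h h'

instance : Trans WordEquiv WordEquiv WordEquiv := ⟨trans⟩

theorem append_left (l : List Letter) {w w' : List Letter} (h : WordEquiv w w') :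
    WordEquiv (l ++ w) (l ++ w') := by
  refine Relation.ReflTransGen.lift (l ++ ·) (fun u v huv => ?_) _ _ h
  obtain ⟨l₁, l₂, a, b⟩ := huv
  simpa [Function.onFun] using WordMove.move (l ++ l₁) l₂ a b

theorem append_right (r : List Letter) {w w' : List Letter} (h : WordEquiv w w') :
    WordEquiv (w ++ r) (w' ++ r) := by
  refine Relation.ReflTransGen.lift (· ++ r) (fun u v huv => ?_) _ _ h
  obtain ⟨l₁, l₂, a, b⟩ := huv
  simpa [Function.onFun] using WordMove.move l₁ (l₂ ++ r) a b

theorem moveAt (i : ℕ) (w : List Letter) : WordEquiv w (moveAt i w) := by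
  fun_induction TetrahedralReflection.moveAt i w with
  | case1 a b l => exact Relation.ReflTransGen.single (WordMove.move [] l a b)
  | case2 i a l ih => exact ih.append_left [a]
  | case3 => exact refl _

theorem foldl_moveAt (s : List ℕ) (w : List Letter) :
    WordEquiv w (s.foldl (fun v i => TetrahedralReflection.moveAt i v) w) := by
  induction s generalizing w with
  | nil => exact refl _
  | cons i s ih => exact (WordEquiv.moveAt i w).trans (ih _)

/-- A move permutes the finitely many pairs of letters, and its twelfth power is the identity; hence
eleven further moves undo it. -/
theorem of_move {w w' : List Letter} (h : WordMove w w') : WordEquiv w' w := by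
  obtain ⟨l₁, l₂, a, b⟩ := h
  have key : ∀ a b : Letter, (List.replicate 11 0).foldl
      (fun v i => TetrahedralReflection.moveAt i v) [b, a.conj b] = [a, b] := by decide +kernel
  have h := foldl_moveAt (List.replicate 11 0) [b, a.conj b]
  rw [key] at h
  simpa using (h.append_right l₂).append_left l₁

theorem symm {w w' : List Letter} (h : WordEquiv w w') : WordEquiv w' w := by
  induction h with
  | refl => exact refl _
  | tail _ h ih => exact (of_move h).trans ih

theorem perm_fst {w w' : List Letter} (h : WordEquiv w w') :
    (w.map Prod.fst).Perm (w'.map Prod.fst) := by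
  induction h with
  | refl => exact List.Perm.refl _
  | tail _ h ih =>
    obtain ⟨l₁, l₂, a, b⟩ := h
    refine ih.trans ?_
    simpa [Letter.conj] using (List.Perm.swap b.1 a.1 _).append_left (l₁.map Prod.fst)

theorem length_eq {w w' : List Letter} (h : WordEquiv w w') : w.length = w'.length := by
  simpa using h.perm_fst.length_eq

theorem forall_snd_eq {w w' : List Letter} (h : WordEquiv w w') {p : Fin 4}
    (hw : ∀ a ∈ w, a.2 = p) : ∀ a ∈ w', a.2 = p := by
  induction h with
  | refl => exact hw
  | tail _ h ih =>
    obtain ⟨l₁, l₂, a, b⟩ := h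
    have ha : a.2 = p := ih a (by simp)
    have hb : b.2 = p := ih b (by simp)
    have hab : (a.conj b).2 = p := by rw [Letter.conj_snd_of_eq a b (ha.trans hb.symm), hb]
    intro c hc
    simp only [List.mem_append, List.mem_cons] at hc
    rcases hc with hc | rfl | rfl | hc
    · exact ih c (by simp [hc])
    · exact hb
    · exact hab
    · exact ih c (by simp [hc])

theorem exists_of_walkMeets {p : List Letter → Bool} {s : List ℕ} {w : List Letter}
    (h : walkMeets p s w = true) : ∃ v, WordEquiv w v ∧ p v = true := by
  induction s generalizing w with
  | nil => exact ⟨w, refl _, h⟩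
  | cons i s ih =>
    rcases (Bool.or_eq_true _ _).mp h with h | h
    · exact ⟨w, refl _, h⟩
    · obtain ⟨v, hv, hp⟩ := ih h
      exact ⟨v, (WordEquiv.moveAt i w).trans hv, hp⟩

theorem cons_append (a : Letter) (w : List Letter) :
    ∃ a' : Letter, a'.1 = a.1 ∧ WordEquiv (a :: w) (w ++ [a']) := by
  induction w generalizing a with
  | nil => exact ⟨a, rfl, refl _⟩
  | cons b w ih =>
    obtain ⟨a', ha', h⟩ := ih (a.conj b)
    exact ⟨a', ha', (WordEquiv.moveAt 0 (a :: b :: w)).trans (h.append_left [b])⟩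

theorem exists_sorted (s : Bool) (w : List Letter) :
    ∃ u v, WordEquiv w (u ++ v) ∧ (∀ a ∈ u, a.1 = s) ∧ ∀ a ∈ v, a.1 = !s := by
  induction w with
  | nil => exact ⟨[], [], refl _, by simp, by simp⟩
  | cons a w ih =>
    obtain ⟨u, v, h, hu, hv⟩ := ih
    by_cases ha : a.1 = s
    · exact ⟨a :: u, v, h.append_left [a], by simpa [ha] using hu, hv⟩
    · obtain ⟨a', ha', h'⟩ := cons_append a u
      refine ⟨u, a' :: v, (h.append_left [a]).trans ?_, hu, ?_⟩
      · simpa using h'.append_right v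
      · have : a.1 = !s := Bool.eq_not_of_ne ha
        simpa [ha', this] using hv

end WordEquiv

/-! ### Degenerate words -/

/-- All letters of the word are a reflection or its inverse. -/
def Degenerate (w : List Letter) : Prop := ∃ p, ∀ a ∈ w, a.2 = p

theorem WordEquiv.degenerate {w w' : List Letter} (h : WordEquiv w w') (hw : Degenerate w) :
    Degenerate w' :=
  hw.imp fun _ hp => h.forall_snd_eq hp

theorem exists_mem_ne_of_not_degenerate {w : List Letter} (h : ¬ Degenerate w) :
    ∃ a ∈ w, ∃ b ∈ w, a.2 ≠ b.2 := by
  by_contra! H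
  rcases w with _ | ⟨a, w⟩
  · exact h ⟨0, by simp⟩
  · exact h ⟨a.2, fun b hb => H b hb a (by simp)⟩

theorem not_degenerate_of_mem {w : List Letter} {a b : Letter} (ha : a ∈ w) (hb : b ∈ w)
    (h : a.2 ≠ b.2) : ¬ Degenerate w := fun ⟨_, hp⟩ => h ((hp a ha).trans (hp b hb).symm)

/-! ### Blocks with trivial product -/

/-- A family of words with trivial product, which can be moved past every letter with or
without being conjugated by it. -/
structure IsBlock (B : Letter → List Letter) : Prop where
  comm (a b : Letter) : WordEquiv (b :: B a) (B a ++ [b])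
  conj (a b : Letter) : WordEquiv (B a ++ [b]) (b :: B (a.conj b))

namespace IsBlock

variable {B : Letter → List Letter} (hB : IsBlock B)
include hB

theorem append_comm (w : List Letter) (a : Letter) : WordEquiv (w ++ B a) (B a ++ w) := by
  induction w with
  | nil => simpa using WordEquiv.refl _
  | cons b w ih =>
    refine (ih.append_left [b]).trans ?_
    simpa using (hB.comm a b).append_right w

/-- The block is carried next to `b`, crosses it unchanged in one direction and conjugated in the
other, and is carried back. -/
theorem conj_of_mem {w : List Letter} {b : Letter} (hb : b ∈ w) (a : Letter) :
    WordEquiv (w ++ B a) (w ++ B (a.conj b)) := by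
  obtain ⟨l, r, rfl⟩ := List.append_of_mem hb
  have h₁ : WordEquiv (b :: (r ++ B a)) (b :: (B a ++ r)) :=
    (hB.append_comm r a).append_left [b]
  have h₂ : WordEquiv (b :: B a) (b :: B (a.conj b)) := (hB.comm a b).trans (hB.conj a b)
  have h₃ : WordEquiv (b :: (B (a.conj b) ++ r)) (b :: (r ++ B (a.conj b))) :=
    (hB.append_comm r _).symm.append_left [b]
  simpa using (h₁.trans ((by simpa using h₂.append_right r : WordEquiv _ _).trans h₃)).append_left l

theorem iterate_conj_of_mem {w : List Letter} {b : Letter} (hb : b ∈ w) (a : Letter) (k : ℕ) :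
    WordEquiv (w ++ B a) (w ++ B ((fun c : Letter => c.conj b)^[k] a)) := by
  induction k generalizing a with
  | zero => exact WordEquiv.refl _
  | succ k ih => exact (hB.conj_of_mem hb a).trans (ih _)

/-- Conjugation by `b` fixes the point of `b` and rotates the other three, so at most two iterations
are needed. -/
theorem transport_of_mem {w : List Letter} {a a' b : Letter} (hb : b ∈ w) (ha : a.2 ≠ b.2)
    (ha' : a'.2 ≠ b.2) (h : a.1 = a'.1) : WordEquiv (w ++ B a) (w ++ B a') := by
  have key : ∀ a a' b : Letter, a.2 ≠ b.2 → a'.2 ≠ b.2 → a.1 = a'.1 →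
      ∃ k : Fin 3, (fun c : Letter => c.conj b)^[k] a = a' := by decide +kernel
  obtain ⟨k, rfl⟩ := key a a' b ha ha' h
  exact hB.iterate_conj_of_mem hb a k

/-- Letters at two distinct points generate a transitive action on the labels of a given flag;
conjugating by powers of one, the other and the first again already suffices. -/
theorem transport {w : List Letter} (hw : ¬ Degenerate w) {a a' : Letter} (h : a.1 = a'.1) :
    WordEquiv (w ++ B a) (w ++ B a') := by
  have key : ∀ b b' a a' : Letter, b.2 ≠ b'.2 → a.1 = a'.1 → ∃ i j k : Fin 3,
      (fun c : Letter => c.conj b)^[k] ((fun c : Letter => c.conj b')^[j]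
        ((fun c : Letter => c.conj b)^[i] a)) = a' := by decide +kernel
  obtain ⟨b, hb, b', hb', hne⟩ := exists_mem_ne_of_not_degenerate hw
  obtain ⟨i, j, k, rfl⟩ := key b b' a a' hne h
  exact (hB.iterate_conj_of_mem hb _ i).trans
    ((hB.iterate_conj_of_mem hb' _ j).trans (hB.iterate_conj_of_mem hb _ k))

end IsBlock

/-- A letter three times. -/
def triple (a : Letter) : List Letter := [a, a, a]

/-- A letter followed by its inverse. -/
def cancelingPair (a : Letter) : List Letter := [a, a.inv]

/-- A letter moved right through the block is conjugated by `a³ = 1`; moved left, it conjugates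
every entry of the block. -/
theorem isBlock_triple : IsBlock triple where
  comm a b := by
    have key : ∀ a b : Letter, ((b.conj a).conj a).conj a = b := by decide +kernel
    have h := WordEquiv.foldl_moveAt [0, 1, 2] (b :: triple a)
    simpa [triple, moveAt, key] using h
  conj a b := WordEquiv.foldl_moveAt [2, 1, 0] (triple a ++ [b])

theorem isBlock_cancelingPair : IsBlock cancelingPair where
  comm a b := by
    have key : ∀ a b : Letter, (b.conj a).conj a.inv = b := by decide +kernel
    have h := WordEquiv.foldl_moveAt [0, 1] (b :: cancelingPair a)
    simpa [cancelingPair, moveAt, key] using h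
  conj a b := WordEquiv.foldl_moveAt [1, 0] (cancelingPair a ++ [b])

/-! ### The model over the Eisenstein integers -/

/-- The ring of Eisenstein integers. -/
abbrev Eisenstein := QuadraticAlgebra ℤ (-1) (-1)

/-- The primitive cube root of unity in the Eisenstein integers. -/
def eisensteinOmega : Eisenstein := ⟨0, 1⟩

/-- The matrix over the Eisenstein integers of the reflection with a given label. -/
def modelMatrix (a : Letter) : Matrix (Fin 2) (Fin 2) Eisenstein :=
  cond a.1
    ((![!![⟨-1, -1⟩, ⟨1, 1⟩; 0, 1],
      !![1, 0; 1, ⟨-1, -1⟩],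
      !![0, ⟨0, -1⟩; ⟨0, 1⟩, ⟨0, -1⟩],
      !![⟨0, -1⟩, -1; ⟨-1, -1⟩, 0]] : Fin 4 → Matrix (Fin 2) (Fin 2) Eisenstein) a.2)
    ((![!![⟨0, 1⟩, 1; 0, 1],
      !![1, 0; ⟨0, -1⟩, ⟨0, 1⟩],
      !![⟨1, 1⟩, ⟨-1, -1⟩; ⟨1, 1⟩, 0],
      !![0, ⟨0, 1⟩; -1, ⟨1, 1⟩]] : Fin 4 → Matrix (Fin 2) (Fin 2) Eisenstein) a.2)

theorem modelMatrix_mul_inv : ∀ a : Letter, modelMatrix a * modelMatrix a.inv = 1 := by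
  decide +kernel

/-- The model over the Eisenstein integers of the reflection with a given label. -/
def modelReflection (a : Letter) : GL (Fin 2) Eisenstein where
  val := modelMatrix a
  inv := modelMatrix a.inv
  val_inv := modelMatrix_mul_inv a
  inv_val := by simpa [Letter.inv] using modelMatrix_mul_inv a.inv

theorem modelReflection_inv : ∀ a : Letter, modelReflection a.inv = (modelReflection a)⁻¹ := by
  decide +kernel

theorem modelReflection_conj : ∀ a b : Letter, modelReflection (a.conj b) =
    (modelReflection b)⁻¹ * modelReflection a * modelReflection b := by
  decide +kernel

theorem modelReflection_mul_conj (a b : Letter) : modelReflection b * modelReflection (a.conj b) =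
    modelReflection a * modelReflection b := by
  rw [modelReflection_conj]; group

theorem modelReflection_cube : ∀ a : Letter,
    modelReflection a * modelReflection a * modelReflection a = 1 := by
  decide +kernel

/-- The product of the reflections labelled by the letters of a word. -/
def wordProd (w : List Letter) : GL (Fin 2) Eisenstein := (w.map modelReflection).prod

@[simp] theorem wordProd_append (u v : List Letter) :
    wordProd (u ++ v) = wordProd u * wordProd v := by simp [wordProd]

@[simp] theorem wordProd_cons (a : Letter) (v : List Letter) :
    wordProd (a :: v) = modelReflection a * wordProd v := by simp [wordProd]

@[simp] theorem wordProd_nil : wordProd [] = 1 := by simp [wordProd]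

theorem wordProd_triple (a : Letter) : wordProd (triple a) = 1 := by
  simp [triple, ← mul_assoc, modelReflection_cube]

theorem WordEquiv.wordProd_eq {w w' : List Letter} (h : WordEquiv w w') :
    wordProd w = wordProd w' := by
  induction h with
  | refl => rfl
  | tail _ h ih =>
    obtain ⟨l₁, l₂, a, b⟩ := h
    rw [ih]
    simp only [wordProd_append, wordProd_cons]
    rw [← mul_assoc (modelReflection b), modelReflection_mul_conj, mul_assoc]

/-- The two reflections at one point form, with the identity, a cyclic group of order three. -/
theorem wordProd_of_forall_snd_eq {w : List Letter} {p : Fin 4} (hw : ∀ a ∈ w, a.2 = p) :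
    wordProd w = 1 ∨ ∃ s, wordProd w = modelReflection (s, p) := by
  have key : ∀ p s r, modelReflection (s, p) * modelReflection (r, p) = 1 ∨
      ∃ q, modelReflection (s, p) * modelReflection (r, p) = modelReflection (q, p) := by
    decide +kernel
  induction w with
  | nil => simp
  | cons a w ih =>
    obtain ⟨s, q⟩ := a
    obtain rfl : q = p := hw (s, q) (by simp)
    rw [wordProd_cons]
    rcases ih fun b hb => hw b (by simp [hb]) with h | ⟨r, h⟩
    · exact Or.inr ⟨s, by rw [h, mul_one]⟩
    · rw [h]; exact key q s r

theorem modelReflection_injective : Function.Injective modelReflection := by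
  have key : ∀ a b, modelReflection a = modelReflection b → a = b := by decide +kernel
  exact fun a b => key a b

theorem modelReflection_ne_one : ∀ a, modelReflection a ≠ 1 := by decide +kernel

/-- The number of letters with a given flag. -/
def signCount (s : Bool) (w : List Letter) : ℕ := (w.map Prod.fst).count s

theorem WordEquiv.signCount_eq {w w' : List Letter} (h : WordEquiv w w') (s : Bool) :
    signCount s w = signCount s w' := h.perm_fst.count_eq s

@[simp] theorem signCount_append (s : Bool) (u v : List Letter) :
    signCount s (u ++ v) = signCount s u + signCount s v := by simp [signCount]

theorem signCount_add (w : List Letter) : signCount false w + signCount true w = w.length := by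
  simp [signCount]

theorem signCount_of_forall {s : Bool} {w : List Letter} (h : ∀ a ∈ w, a.1 = s) :
    signCount s w = w.length := by
  rw [signCount, List.count_eq_length.mpr, List.length_map]
  intro b hb
  obtain ⟨a, ha, rfl⟩ := List.mem_map.mp hb
  exact (h a ha).symm

theorem signCount_not_of_forall {s : Bool} {w : List Letter} (h : ∀ a ∈ w, a.1 = s) :
    signCount (!s) w = 0 := by
  rw [signCount, List.count_eq_zero]
  rintro h'
  obtain ⟨a, ha, hs⟩ := List.mem_map.mp h'
  have := h a ha
  cases s <;> simp_all

theorem det_wordProd (w : List Letter) : ((wordProd w : Matrix (Fin 2) (Fin 2) Eisenstein)).det =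
    eisensteinOmega ^ (signCount false w + 2 * signCount true w) := by
  have key : ∀ a : Letter, (modelReflection a : Matrix (Fin 2) (Fin 2) Eisenstein).det =
      cond a.1 (eisensteinOmega ^ 2) eisensteinOmega := by decide +kernel
  induction w with
  | nil => simp [signCount]
  | cons a w ih =>
    rw [wordProd_cons, Units.val_mul, Matrix.det_mul, ih, key]
    rcases a with ⟨_ | _, p⟩ <;> simp [signCount] <;> ring

/-- Compare determinants: flag `false` contributes `ω`, flag `true` contributes `ω²`, and `ω` has
order three. -/
theorem signCount_modEq {w : List Letter} {p : Fin 4}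
    (h : wordProd w = modelReflection (false, p)) :
    (signCount false w + 2 * signCount true w) % 3 = 1 := by
  have h₁ := det_wordProd w
  have h₂ := det_wordProd [(false, p)]
  rw [wordProd_cons, wordProd_nil, mul_one, ← h, h₁] at h₂
  set k := signCount false w + 2 * signCount true w with hk
  have h₃ : eisensteinOmega ^ k = eisensteinOmega := by simpa [signCount] using h₂
  have h₄ : eisensteinOmega ^ 3 = 1 := by decide +kernel
  rw [← Nat.div_add_mod k 3, pow_add, pow_mul, h₄, one_pow, one_mul] at h₃
  have : k % 3 < 3 := Nat.mod_lt _ (by norm_num)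
  have h₅ : ∀ r < 3, eisensteinOmega ^ r = eisensteinOmega → r = 1 := by decide +kernel
  exact h₅ _ this h₃

/-! ### Extracting a cube -/

/-- The word is equivalent to one that ends with three equal letters. -/
def HasCube (w : List Letter) : Prop := ∃ u a, WordEquiv w (u ++ triple a)

theorem WordEquiv.hasCube {w w' : List Letter} (h : WordEquiv w w') (h' : HasCube w') :
    HasCube w := by
  obtain ⟨u, a, hu⟩ := h'
  exact ⟨u, a, h.trans hu⟩

theorem HasCube.append {v : List Letter} (h : HasCube v) (l r : List Letter) :
    HasCube (l ++ v ++ r) := by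
  obtain ⟨u, a, hu⟩ := h
  refine ⟨l ++ u ++ r, a, ((hu.append_left l).append_right r).trans ?_⟩
  simpa using (isBlock_triple.append_comm r a).symm.append_left (l ++ u)

/-- Whether three consecutive letters coincide. -/
def hasTriple : List Letter → Bool
  | a :: b :: c :: l => (a == b && b == c) || hasTriple (b :: c :: l)
  | _ => false

theorem hasCube_of_hasTriple {w : List Letter} (h : hasTriple w = true) : HasCube w := by
  fun_induction hasTriple w with
  | case1 a b c l ih =>
    rcases (Bool.or_eq_true _ _).mp h with h | h
    · obtain ⟨rfl, rfl⟩ : a = b ∧ b = c := by simpa using h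
      exact HasCube.append (v := triple a) ⟨[], a, WordEquiv.refl _⟩ [] l
    · simpa using (ih h).append [a] []
  | case2 => simp at h

theorem hasCube_of_walkMeets {w : List Letter} {s : List ℕ}
    (h : walkMeets hasTriple s w = true) : HasCube w := by
  obtain ⟨v, hv, hp⟩ := WordEquiv.exists_of_walkMeets h
  exact hv.hasCube (hasCube_of_hasTriple hp)

/-- Simultaneous conjugation of all letters of a word. -/
def conjWord (c : Letter) (w : List Letter) : List Letter := w.map fun a => a.conj c

theorem Letter.conj_conj : ∀ a b c : Letter,
    (a.conj b).conj c = (a.conj c).conj (b.conj c) := by decide +kernel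

theorem WordEquiv.conjWord (c : Letter) {w w' : List Letter} (h : WordEquiv w w') :
    WordEquiv (conjWord c w) (conjWord c w') := by
  refine Relation.ReflTransGen.lift (TetrahedralReflection.conjWord c) (fun u v huv => ?_) _ _ h
  obtain ⟨l₁, l₂, a, b⟩ := huv
  simpa [TetrahedralReflection.conjWord, Function.onFun, Letter.conj_conj a b c] using
    WordMove.move (l₁.map fun a => a.conj c) (l₂.map fun a => a.conj c) (a.conj c) (b.conj c)

/-- This permits normalizing the first two letters before a finite check. -/
theorem hasCube_conjWord_iff (c : Letter) (w : List Letter) :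
    HasCube (conjWord c w) ↔ HasCube w := by
  have mp : ∀ w, HasCube w → HasCube (conjWord c w) := by
    rintro w ⟨u, a, h⟩
    exact ⟨conjWord c u, a.conj c, by simpa [conjWord, triple] using h.conjWord c⟩
  -- Conjugating three times by `c` is trivial, so two more conjugations invert the first.
  have key : ∀ a c : Letter, ((a.conj c).conj c).conj c = a := by decide +kernel
  refine ⟨fun h => ?_, mp w⟩
  simpa [conjWord, key, Function.comp_def] using mp _ (mp _ h)

/-- The alternating group is doubly transitive on the four points; two letters are enough to realize
the required conjugation. -/
theorem exists_conj_conj : ∀ (s : Bool) (a b : Fin 4), ∃ x y : Letter,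
    ((Letter.conj (s, a) x).conj y).2 = 0 ∧
      (((Letter.conj (s, b) x).conj y).2 = 0 ∨ ((Letter.conj (s, b) x).conj y).2 = 1) := by
  decide +kernel

theorem hasCube_five (s : Bool) (a b c d e : Fin 4) :
    HasCube [(s, a), (s, b), (s, c), (s, d), (s, e)] := by
  -- One walk serves every normalized word: each of them meets three equal adjacent letters
  -- somewhere along it.
  have key : ∀ (s : Bool) (b c d e : Fin 4), (b = 0 ∨ b = 1) → walkMeets hasTriple
      [2, 1, 1, 2, 1, 1, 2, 2, 3, 2, 0, 3, 0, 1, 1, 3, 3, 2, 0, 1, 1, 3, 3, 2, 2, 3, 0, 3, 2, 2,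
        3, 0, 1, 3, 1, 0, 1, 3, 3, 1, 0, 2, 1, 1, 3, 0]
      [(s, 0), (s, b), (s, c), (s, d), (s, e)] = true := by decide +kernel
  obtain ⟨x, y, ha, hb⟩ := exists_conj_conj s a b
  rw [← hasCube_conjWord_iff x, ← hasCube_conjWord_iff y]
  have h := hasCube_of_walkMeets (key s _ ((Letter.conj (s, c) x).conj y).2
    ((Letter.conj (s, d) x).conj y).2 ((Letter.conj (s, e) x).conj y).2 hb)
  rwa [← ha] at h

theorem hasCube_three_two (s : Bool) (a b c d e : Fin 4) :
    HasCube [(s, a), (s, b), (s, c), (!s, d), (!s, e)] := by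
  have key : ∀ (s : Bool) (b c d e : Fin 4), (b = 0 ∨ b = 1) → walkMeets hasTriple
      [2, 3, 3, 2, 2, 2, 3, 2, 2, 2, 1, 1, 2, 2, 2, 1, 3, 2, 2, 0, 1, 2, 2, 3, 2, 2, 2, 1, 1, 2,
        2, 2, 3, 2, 2, 2, 1, 0, 0, 0, 3, 3, 1, 0, 0, 3, 3, 1, 0, 0, 3, 3, 2, 3, 3, 0, 0, 2, 3, 3,
        0, 0, 0, 1, 1, 0, 3, 3, 0, 0, 3, 3, 2, 3, 3, 0, 0, 1, 0, 0, 1, 2, 3, 3, 0, 0, 3, 3, 1, 2,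
        2, 3, 3, 0, 0, 2, 3, 3, 1, 0, 0, 1, 3, 2, 2, 3, 3, 3, 1, 0, 0, 2, 3, 3, 0, 0, 1, 0, 0, 3,
        2, 2, 3, 2, 1, 0, 0, 1, 1, 0, 0]
      [(s, 0), (s, b), (s, c), (!s, d), (!s, e)] = true := by decide +kernel
  obtain ⟨x, y, ha, hb⟩ := exists_conj_conj s a b
  rw [← hasCube_conjWord_iff x, ← hasCube_conjWord_iff y]
  have h := hasCube_of_walkMeets (key s _ ((Letter.conj (s, c) x).conj y).2
    ((Letter.conj (!s, d) x).conj y).2 ((Letter.conj (!s, e) x).conj y).2 hb)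
  rwa [← ha] at h

/-- Removing a cube leaves one letter with the same product, so the condition on the product is
necessary; the enumeration shows that it suffices. -/
theorem hasCube_four (a b c d p : Fin 4)
    (h : wordProd [(false, a), (false, b), (false, c), (false, d)] = modelReflection (false, p)) :
    HasCube [(false, a), (false, b), (false, c), (false, d)] := by
  have key : ∀ a b c d : Fin 4,
      walkMeets hasTriple [0, 0, 1, 0, 0, 1, 0, 0, 1, 0]
        [(false, a), (false, b), (false, c), (false, d)] = true ∨
      ∀ p, modelMatrix (false, a) * (modelMatrix (false, b) * (modelMatrix (false, c) *
        modelMatrix (false, d))) ≠ modelMatrix (false, p) := by decide +kernel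
  refine hasCube_of_walkMeets ((key a b c d).resolve_right fun H => H p ?_)
  simpa [modelReflection] using congrArg Units.val h

theorem hasCube_one_three (a b c d p : Fin 4)
    (h : wordProd [(false, a), (true, b), (true, c), (true, d)] = modelReflection (false, p)) :
    HasCube [(false, a), (true, b), (true, c), (true, d)] := by
  have key : ∀ a b c d : Fin 4,
      walkMeets hasTriple [0, 0, 1, 0, 0, 0, 1, 1, 0, 2, 0, 1, 1, 0, 0, 0, 1, 0, 0, 1, 0, 0, 2, 1,
          1, 0, 0]
        [(false, a), (true, b), (true, c), (true, d)] = true ∨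
      ∀ p, modelMatrix (false, a) * (modelMatrix (true, b) * (modelMatrix (true, c) *
        modelMatrix (true, d))) ≠ modelMatrix (false, p) := by decide +kernel
  refine hasCube_of_walkMeets ((key a b c d).resolve_right fun H => H p ?_)
  simpa [modelReflection] using congrArg Units.val h

theorem snd_eq_of_mul_eq : ∀ a b : Letter, ∀ p,
    modelReflection a * modelReflection b = modelReflection (false, p) → a.2 = b.2 := by
  decide +kernel

/-- The base case of the induction, again by a single walk that works for all words concerned. -/
theorem exists_cancelingPair_of_length_three (a b c : Letter) (p : Fin 4)
    (h : wordProd [a, b, c] = modelReflection (false, p)) (hd : ¬ Degenerate [a, b, c]) :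
    ∃ q ≠ p, WordEquiv [a, b, c] ((false, p) :: cancelingPair (false, q)) := by
  have key : ∀ a b c : Letter, ∀ p, modelMatrix a * (modelMatrix b * modelMatrix c) =
      modelMatrix (false, p) → (a.2 = c.2 ∧ b.2 = c.2) ∨
      walkMeets (fun v => decide (∃ q ≠ p, v = (false, p) :: cancelingPair (false, q)))
        [0, 0, 1, 0, 1, 0, 0, 1] [a, b, c] = true := by decide +kernel
  have h : modelMatrix a * (modelMatrix b * modelMatrix c) = modelMatrix (false, p) := by
    simpa [modelReflection] using congrArg Units.val h
  rcases key a b c p h with h' | h'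
  · exact absurd ⟨c.2, by simpa using h'⟩ hd
  · obtain ⟨v, hv, hp⟩ := WordEquiv.exists_of_walkMeets h'
    obtain ⟨q, hq, rfl⟩ := of_decide_eq_true hp
    exact ⟨q, hq, hv⟩

theorem hasCube_of_five_le_length {w : List Letter} {s : Bool} (hw : ∀ a ∈ w, a.1 = s)
    (h : 5 ≤ w.length) : HasCube w := by
  match w, h with
  | (s₁, a) :: (s₂, b) :: (s₃, c) :: (s₄, d) :: (s₅, e) :: l, _ =>
    simp only [List.mem_cons, forall_eq_or_imp] at hw
    obtain ⟨rfl, rfl, rfl, rfl, rfl, -⟩ := hw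
    simpa using (hasCube_five s₅ a b c d e).append [] l

theorem hasCube_of_three_two {s : Bool} {u v : List Letter} (hu : ∀ a ∈ u, a.1 = s)
    (hv : ∀ a ∈ v, a.1 = !s) (h₁ : 3 ≤ u.length) (h₂ : 2 ≤ v.length) : HasCube (u ++ v) := by
  obtain ⟨l, u', rfl, hl⟩ : ∃ l u', u = l ++ u' ∧ u'.length = 3 :=
    ⟨u.take (u.length - 3), u.drop (u.length - 3), (List.take_append_drop _ _).symm, by
      rw [List.length_drop]; omega⟩
  obtain ⟨⟨s₁, a⟩, ⟨s₂, b⟩, ⟨s₃, c⟩, rfl⟩ := List.length_eq_three.mp hl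
  match v, h₂ with
  | (s₄, d) :: (s₅, e) :: r, _ =>
    simp only [List.mem_cons, List.mem_append, or_imp, forall_and, forall_eq] at hu hv
    obtain ⟨-, rfl, rfl, rfl, -⟩ := hu
    obtain ⟨rfl, rfl, -⟩ := hv
    simpa using (hasCube_three_two s₃ a b c d e).append l r

/-- Sorting the letters by flag leaves only the two counts to consider. Five equal flags, or three
of one and two of the other, force a cube whatever the product is. -/
theorem hasCube_of_wordProd_eq {w : List Letter} {p : Fin 4}
    (hw : wordProd w = modelReflection (false, p)) (hl : 4 ≤ w.length) : HasCube w := by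
  obtain ⟨u, v, h, hu, hv⟩ := WordEquiv.exists_sorted false w
  obtain ⟨v', u', h', hv', hu'⟩ := WordEquiv.exists_sorted true w
  have hprod := h.wordProd_eq.symm.trans hw
  have hmod := signCount_modEq hprod
  have hlen := h.length_eq
  have e₁ := h.symm.trans h' |>.signCount_eq false
  have e₂ := h.symm.trans h' |>.signCount_eq true
  have hvf : signCount false v = 0 := signCount_not_of_forall (s := true) hv
  have hut : signCount true u = 0 := signCount_not_of_forall (s := false) hu
  have hvf' : signCount false v' = 0 := signCount_not_of_forall (s := true) hv'
  have hut' : signCount true u' = 0 := signCount_not_of_forall (s := false) hu'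
  have hvt : signCount true v = v.length := signCount_of_forall hv
  have huf : signCount false u' = u'.length := signCount_of_forall hu'
  simp only [signCount_append, signCount_of_forall hu, signCount_of_forall hv', hvt, huf, hvf, hut,
    hvf', hut', List.length_append] at hmod hlen e₁ e₂
  by_cases h₁ : 5 ≤ u.length
  · exact h.hasCube (by simpa using (hasCube_of_five_le_length hu h₁).append [] v)
  by_cases h₂ : 5 ≤ v.length
  · exact h.hasCube (by simpa using (hasCube_of_five_le_length hv h₂).append u [])
  by_cases h₃ : 3 ≤ u.length ∧ 2 ≤ v.length
  · exact h.hasCube (hasCube_of_three_two hu hv h₃.1 h₃.2)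
  by_cases h₄ : 3 ≤ v.length ∧ 2 ≤ u.length
  · exact h'.hasCube (hasCube_of_three_two hv' hu' (by omega) (by omega))
  refine h.hasCube ?_
  -- The determinant congruence rules out the other small counts: (4,1), (3,1), (2,2), (1,4) and
  -- (0,4).
  have hcases : (u.length = 4 ∧ v.length = 0) ∨ (u.length = 1 ∧ v.length = 3) := by
    have : v.length = 0 ∨ v.length = 1 ∨ v.length = 2 ∨ v.length = 3 ∨ v.length = 4 := by omega
    omega
  rcases hcases with ⟨h₅, h₆⟩ | ⟨h₅, h₆⟩
  · obtain rfl := List.length_eq_zero_iff.mp h₆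
    match u, h₅ with
    | [(s₁, a), (s₂, b), (s₃, c), (s₄, d)], _ =>
      simp only [List.mem_cons, or_imp, forall_and, forall_eq] at hu
      obtain ⟨rfl, rfl, rfl, rfl, -⟩ := hu
      simpa using hasCube_four a b c d p (by simpa using hprod)
  · obtain ⟨⟨s₁, a⟩, rfl⟩ := List.length_eq_one_iff.mp h₅
    obtain ⟨⟨s₂, b⟩, ⟨s₃, c⟩, ⟨s₄, d⟩, rfl⟩ := List.length_eq_three.mp h₆
    simp only [List.mem_cons, or_imp, forall_and, forall_eq] at hu hv
    obtain ⟨rfl, -⟩ := hu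
    obtain ⟨rfl, rfl, rfl, -⟩ := hv
    simpa using hasCube_one_three a b c d p (by simpa using hprod)

/-! ### Standard words and added cubes -/

/-- The word that labels a standard factorization. -/
def standardWord (x y : Letter) (n m : ℕ) : List Letter :=
  if n % 3 = 2 ∧ m % 3 = 1 then
    List.replicate (n - 2) x ++ [x, y.inv, y] ++ List.replicate (m - 1) y
  else if n % 3 = 1 ∧ m % 3 = 0 ∧ 3 ≤ m then
    List.replicate n x ++ List.replicate m y
  else if n % 3 = 1 ∧ m = 0 then
    List.replicate (n - 4) x ++ [x, y.inv, y.inv, y.inv]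
  else if n % 3 = 0 ∧ m % 3 = 2 ∧ 5 ≤ m then
    List.replicate n x ++ [x.inv, x.inv] ++ List.replicate (m - 2) y
  else if n % 3 = 0 ∧ m = 2 then
    List.replicate (n - 3) x ++ [x.inv, x.inv, y.inv, y.inv, y.inv]
  else []

theorem replicate_three_add (k : ℕ) (a : Letter) :
    List.replicate (3 + k) a = triple a ++ List.replicate k a := by
  rw [List.replicate_add]; rfl

theorem replicate_add_three (k : ℕ) (a : Letter) :
    List.replicate (k + 3) a = List.replicate k a ++ triple a := by
  rw [List.replicate_add]; rfl

section Standard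

variable {x y : Letter} {n m : ℕ}

theorem standardWord_two_one (hn : n % 3 = 2) (hm : m % 3 = 1) : standardWord x y n m =
    List.replicate (n - 2) x ++ [x, y.inv, y] ++ List.replicate (m - 1) y := by
  simp [standardWord, hn, hm]

theorem standardWord_one_zero (hn : n % 3 = 1) (hm : m % 3 = 0) (h : 3 ≤ m) :
    standardWord x y n m = List.replicate n x ++ List.replicate m y := by
  simp [standardWord, hn, hm, h]

theorem standardWord_one_zero' (hn : n % 3 = 1) : standardWord x y n 0 =
    List.replicate (n - 4) x ++ [x, y.inv, y.inv, y.inv] := by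
  simp [standardWord, hn]

theorem standardWord_zero_two (hn : n % 3 = 0) (hm : m % 3 = 2) (h : 5 ≤ m) :
    standardWord x y n m = List.replicate n x ++ [x.inv, x.inv] ++ List.replicate (m - 2) y := by
  simp [standardWord, hn, hm, h]

theorem standardWord_zero_two' (hn : n % 3 = 0) : standardWord x y n 2 =
    List.replicate (n - 3) x ++ [x.inv, x.inv, y.inv, y.inv, y.inv] := by
  simp [standardWord, hn]

theorem residue_cases (hmod : (n + 2 * m) % 3 = 1) :
    (n % 3 = 2 ∧ m % 3 = 1) ∨ (n % 3 = 1 ∧ m % 3 = 0 ∧ 3 ≤ m) ∨ (n % 3 = 1 ∧ m = 0) ∨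
      (n % 3 = 0 ∧ m % 3 = 2 ∧ 5 ≤ m) ∨ (n % 3 = 0 ∧ m = 2) := by
  have : n % 3 = 0 ∨ n % 3 = 1 ∨ n % 3 = 2 := by omega
  have : m % 3 = 0 ∨ m % 3 = 1 ∨ m % 3 = 2 := by omega
  omega

/-- The length condition excludes `(1, 0)` and `(0, 2)`, where the truncated subtractions `n - 4`
and `n - 3` would give a word of the wrong length. -/
theorem standardWord_add_left (hmod : (n + 2 * m) % 3 = 1)
    (hlen : (standardWord x y n m).length = n + m) :
    standardWord x y (n + 3) m = triple x ++ standardWord x y n m := by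
  rcases residue_cases hmod with ⟨hn, hm⟩ | ⟨hn, hm, h⟩ | ⟨hn, rfl⟩ | ⟨hn, hm, h⟩ | ⟨hn, rfl⟩
  · rw [standardWord_two_one hn hm, standardWord_two_one (by omega) hm,
      show n + 3 - 2 = 3 + (n - 2) by omega, replicate_three_add]; simp
  · rw [standardWord_one_zero hn hm h, standardWord_one_zero (by omega) hm h,
      show n + 3 = 3 + n by omega, replicate_three_add]; simp
  · rw [standardWord_one_zero' hn] at hlen
    simp only [List.length_append, List.length_replicate, List.length_cons, List.length_nil]
      at hlen
    rw [standardWord_one_zero' hn, standardWord_one_zero' (by omega),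
      show n + 3 - 4 = 3 + (n - 4) by omega, replicate_three_add]; simp
  · rw [standardWord_zero_two hn hm h, standardWord_zero_two (by omega) hm h,
      show n + 3 = 3 + n by omega, replicate_three_add]; simp
  · rw [standardWord_zero_two' hn] at hlen
    simp only [List.length_append, List.length_replicate, List.length_cons, List.length_nil]
      at hlen
    rw [standardWord_zero_two' hn, standardWord_zero_two' (by omega),
      show n + 3 - 3 = 3 + (n - 3) by omega, replicate_three_add]; simp

/-- The cube of `y⁻¹` has the flag of `x`; moved to the end, it can be transported to a cube of `x`
and then brought to the front. -/
theorem append_triple_inv_triple_equiv {w : List Letter} (hw : ¬ Degenerate (w ++ triple y))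
    (hxy : x.1 = y.inv.1) :
    WordEquiv (w ++ triple y.inv ++ triple y) (triple x ++ (w ++ triple y)) := by
  have h₁ : WordEquiv (w ++ triple y.inv ++ triple y) (w ++ triple y ++ triple y.inv) := by
    simpa using (isBlock_triple.append_comm (triple y.inv) y).append_left w
  exact (h₁.trans (isBlock_triple.transport hw hxy.symm)).trans (isBlock_triple.append_comm _ _)

/-- Only `m = 0` and `m = 2` need work: there the standard shape ends in `y⁻¹` cubed, which has to
become `x³` once `y³` is present. -/
theorem standardWord_add_right (hx : x.1 = false) (hy : y.1 = true) (hxy : y.2 ≠ x.2)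
    (hmod : (n + 2 * m) % 3 = 1) (hlen : (standardWord x y n m).length = n + m) :
    WordEquiv (standardWord x y n m ++ triple y) (standardWord x y n (m + 3)) := by
  have hsign : x.1 = y.inv.1 := by simp [Letter.inv, hx, hy]
  rcases residue_cases hmod with ⟨hn, hm⟩ | ⟨hn, hm, h⟩ | ⟨hn, rfl⟩ | ⟨hn, hm, h⟩ | ⟨hn, rfl⟩
  · rw [standardWord_two_one hn hm, standardWord_two_one hn (by omega),
      show m + 3 - 1 = m - 1 + 3 by omega, replicate_add_three]
    simpa using WordEquiv.refl _
  · rw [standardWord_one_zero hn hm h, standardWord_one_zero hn (by omega) (by omega),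
      replicate_add_three]
    simpa using WordEquiv.refl _
  · rw [standardWord_one_zero' hn] at hlen ⊢
    simp only [List.length_append, List.length_replicate, List.length_cons, List.length_nil]
      at hlen
    obtain ⟨k, rfl⟩ : ∃ k, n = 3 + (k + 1) := ⟨n - 4, by omega⟩
    rw [standardWord_one_zero hn (by omega) (by omega), replicate_three_add]
    have h := append_triple_inv_triple_equiv (x := x) (y := y) (w := List.replicate (k + 1) x)
      (not_degenerate_of_mem (a := y) (b := x) (by simp [triple]) (by simp) hxy) hsign
    rw [show 3 + (k + 1) - 4 = k by omega]
    simpa [triple, List.replicate_succ'] using h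
  · rw [standardWord_zero_two hn hm h, standardWord_zero_two hn (by omega) (by omega),
      show m + 3 - 2 = m - 2 + 3 by omega, replicate_add_three]
    simpa using WordEquiv.refl _
  · rw [standardWord_zero_two' hn] at hlen ⊢
    simp only [List.length_append, List.length_replicate, List.length_cons, List.length_nil]
      at hlen
    obtain ⟨k, rfl⟩ : ∃ k, n = 3 + k := ⟨n - 3, by omega⟩
    rw [standardWord_zero_two hn (by omega) (by omega), replicate_three_add]
    have h := append_triple_inv_triple_equiv (x := x) (y := y)
      (w := List.replicate k x ++ [x.inv, x.inv])
      (not_degenerate_of_mem (a := y) (b := x.inv) (by simp [triple]) (by simp) hxy) hsign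
    rw [show 3 + k - 3 = k by omega]
    simpa [triple] using h

end Standard

/-- Adding a triple to a word that is equivalent to a standard word gives such a word. -/
theorem equiv_standardWord_append_triple {x y a : Letter} (hx : x.1 = false) (hy : y.1 = true)
    (hxy : y.2 ≠ x.2) {u : List Letter} (hu : ¬ Degenerate u)
    (hprod : wordProd u = modelReflection x)
    (h : WordEquiv u (standardWord x y (signCount false u) (signCount true u))) :
    WordEquiv (u ++ triple a) (standardWord x y (signCount false (u ++ triple a))
      (signCount true (u ++ triple a))) := by
  obtain ⟨s, p⟩ := x
  obtain rfl : s = false := hx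
  have hmod := signCount_modEq hprod
  have hlen := h.length_eq.symm.trans (signCount_add u).symm
  rcases a with ⟨_ | _, q⟩
  · have h₁ : signCount false (triple (false, q)) = 3 := rfl
    have h₂ : signCount true (triple (false, q)) = 0 := rfl
    rw [signCount_append, signCount_append, h₁, h₂, add_zero, standardWord_add_left hmod hlen]
    exact ((isBlock_triple.transport hu (a := (false, q)) (a' := (false, p)) rfl).trans
      (isBlock_triple.append_comm _ _)).trans (h.append_left _)
  · have h₁ : signCount false (triple (true, q)) = 0 := rfl
    have h₂ : signCount true (triple (true, q)) = 3 := rfl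
    rw [signCount_append, signCount_append, h₁, h₂]
    exact ((isBlock_triple.transport hu (a' := y) hy.symm).trans
      (h.append_right _)).trans (standardWord_add_right rfl hy hxy hmod hlen)

/-- Shorter words would be degenerate, so the length is three; the cancelling pair is then rotated
about `x` until it becomes `y⁻¹, y`. -/
theorem equiv_standardWord_of_length_le_three {x y : Letter} (hx : x.1 = false) (hy : y.1 = true)
    (hxy : y.2 ≠ x.2) {w : List Letter} (hw : ¬ Degenerate w)
    (hprod : wordProd w = modelReflection x) (hlen : w.length ≤ 3) :
    WordEquiv w (standardWord x y (signCount false w) (signCount true w)) := by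
  obtain ⟨s, p⟩ := x
  obtain rfl : s = false := hx
  match w, hlen with
  | [], _ => exact absurd ⟨0, by simp⟩ hw
  | [a], _ => exact absurd ⟨a.2, by simp⟩ hw
  | [a, b], _ => exact absurd ⟨b.2, by simpa using snd_eq_of_mul_eq a b p (by simpa using hprod)⟩ hw
  | [a, b, c], _ =>
    obtain ⟨q, hq, h⟩ := exists_cancelingPair_of_length_three a b c p hprod hw
    have h₁ : signCount false [a, b, c] = 2 := h.signCount_eq false
    have h₂ : signCount true [a, b, c] = 1 := h.signCount_eq true
    rw [h₁, h₂]
    refine h.trans ?_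
    have h₃ := isBlock_cancelingPair.transport_of_mem (w := [(false, p)]) (a := (false, q))
      (a' := y.inv) (b := (false, p)) (by simp) hq hxy (by simp [Letter.inv, hy])
    simpa [cancelingPair, standardWord, Letter.inv] using h₃

/-- In a cyclic group of order three the exponents `±1` must add up to 1 modulo 3. -/
theorem eq_of_degenerate_of_length_le_three (p : Fin 4) {u : List Letter}
    (hu : ∀ a ∈ u, a.2 = p) (hprod : wordProd u = modelReflection (false, p))
    (hlen : u.length ≤ 3) : u = [(false, p)] ∨ u = [(true, p), (true, p)] ∨
      WordEquiv u [(false, p), (false, p), (true, p)] := by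
  have key₁ : ∀ p s, modelMatrix (s, p) = modelMatrix (false, p) → s = false := by
    decide +kernel
  have key₂ : ∀ p s r, modelMatrix (s, p) * modelMatrix (r, p) = modelMatrix (false, p) →
      s = true ∧ r = true := by decide +kernel
  have key₃ : ∀ p s r q, modelMatrix (s, p) * (modelMatrix (r, p) * modelMatrix (q, p)) =
      modelMatrix (false, p) → walkMeets (fun v => v == [(false, p), (false, p), (true, p)])
        [1, 0, 1] [(s, p), (r, p), (q, p)] = true := by decide +kernel
  match u, hlen with
  | [], _ => exact absurd hprod.symm (modelReflection_ne_one _)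
  | [(s, a)], _ =>
    obtain rfl : a = p := hu (s, a) (by simp)
    have h := key₁ a s (by simpa [modelReflection] using congrArg Units.val hprod)
    simp [h]
  | [(s, a), (r, b)], _ =>
    simp only [List.mem_cons, or_imp, forall_and, forall_eq] at hu
    obtain ⟨rfl, rfl, -⟩ := hu
    have h := key₂ b s r (by simpa [modelReflection] using congrArg Units.val hprod)
    simp [h]
  | [(s, a), (r, b), (q, c)], _ =>
    simp only [List.mem_cons, or_imp, forall_and, forall_eq] at hu
    obtain ⟨rfl, rfl, rfl, -⟩ := hu
    have h := key₃ c s r q (by simpa [modelReflection] using congrArg Units.val hprod)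
    obtain ⟨v, hv, hp⟩ := WordEquiv.exists_of_walkMeets h
    obtain rfl : v = _ := by simpa using hp
    exact Or.inr (Or.inr hv)

/-- A nondegenerate word whose product is a reflection `x` of the first class is equivalent to a
standard word. -/
theorem equiv_standardWord {x y : Letter} (hx : x.1 = false) (hy : y.1 = true) (hxy : y.2 ≠ x.2)
    (w : List Letter) (hw : ¬ Degenerate w) (hprod : wordProd w = modelReflection x) :
    WordEquiv w (standardWord x y (signCount false w) (signCount true w)) := by
  induction hk : w.length using Nat.strong_induction_on generalizing w with
  | _ k ih =>
  subst hk
  -- Inductive step: it is enough to split off a cube with a nondegenerate rest.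
  have step : ∀ u a, WordEquiv w (u ++ triple a) → ¬ Degenerate u →
      WordEquiv w (standardWord x y (signCount false w) (signCount true w)) := by
    intro u a h hu
    have hpu : wordProd u = modelReflection x := by
      rw [← hprod, h.wordProd_eq, wordProd_append, wordProd_triple, mul_one]
    have hl : u.length < w.length := by
      rw [h.length_eq, List.length_append]; simp [triple]
    rw [h.signCount_eq, h.signCount_eq]
    exact h.trans (equiv_standardWord_append_triple hx hy hxy hu hpu (ih _ hl u hu hpu rfl))
  rcases Nat.lt_or_ge 3 w.length with hlen | hlen
  swap
  · exact equiv_standardWord_of_length_le_three hx hy hxy hw hprod hlen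
  obtain ⟨s, p⟩ := x
  obtain rfl : s = false := hx
  obtain ⟨u, a, h⟩ := hasCube_of_wordProd_eq hprod hlen
  by_cases hu : Degenerate u
  swap
  · exact step u a h hu
  have hpu : wordProd u = modelReflection (false, p) := by
    rw [← hprod, h.wordProd_eq, wordProd_append, wordProd_triple, mul_one]
  obtain ⟨q, hq⟩ := hu
  obtain rfl : q = p := by
    rcases wordProd_of_forall_snd_eq hq with h' | ⟨s, h'⟩
    · exact absurd (hpu.symm.trans h') (modelReflection_ne_one _)
    · exact (congrArg Prod.snd (modelReflection_injective (hpu.symm.trans h'))).symm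
  -- Otherwise the whole word would be degenerate.
  have ha : a.2 ≠ q := by
    intro ha
    refine hw (h.symm.degenerate ⟨q, fun b hb => ?_⟩)
    rcases List.mem_append.mp hb with hb | hb
    · exact hq b hb
    · obtain rfl : b = a := by simpa [triple] using hb
      exact ha
  rcases Nat.lt_or_ge 3 u.length with hlu | hlu
  · obtain ⟨v, b, hv⟩ := hasCube_of_wordProd_eq hpu hlu
    have hvq := hv.forall_snd_eq hq
    -- A second cube is taken from the degenerate part and split off in place of the first. The rest
    -- contains `a` and a letter of `v`, which is nonempty because its product is not 1.
    refine step (v ++ triple a) b ?_ ?_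
    · refine (h.trans (hv.append_right _)).trans ?_
      simpa using (isBlock_triple.append_comm (triple b) a).append_left v
    · obtain ⟨c, hc⟩ : ∃ c, c ∈ v := by
        refine List.exists_mem_of_ne_nil v ?_
        rintro rfl
        rw [hv.wordProd_eq, List.nil_append, wordProd_triple] at hpu
        exact modelReflection_ne_one _ hpu.symm
      refine not_degenerate_of_mem (a := a) (b := c) (by simp [triple]) (by simp [hc]) ?_
      rwa [hvq c (by simp [hc])]
  -- The first two forms, with either flag of `a`, give the counts (4,0), (1,3), (3,2) and (0,5),
  -- where rotating the cube about `x` is enough.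
  rcases eq_of_degenerate_of_length_le_three q hq hpu hlu with rfl | rfl | hu
  · rw [h.signCount_eq, h.signCount_eq]
    refine h.trans ?_
    rcases a with ⟨_ | _, r⟩
    · have h₁ := isBlock_triple.transport_of_mem (w := [(false, q)]) (b := (false, q))
        (a := (false, r)) (a' := y.inv) (by simp) ha hxy (by simp [Letter.inv, hy])
      have h₂ : signCount false ([(false, q)] ++ triple (false, r)) = 4 := rfl
      have h₃ : signCount true ([(false, q)] ++ triple (false, r)) = 0 := rfl
      rw [h₂, h₃]
      simpa [standardWord, triple, List.replicate, Letter.inv] using h₁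
    · have h₁ := isBlock_triple.transport_of_mem (w := [(false, q)]) (b := (false, q))
        (a := (true, r)) (a' := y) (by simp) ha hxy (by simp [hy])
      have h₂ : signCount false ([(false, q)] ++ triple (true, r)) = 1 := rfl
      have h₃ : signCount true ([(false, q)] ++ triple (true, r)) = 3 := rfl
      rw [h₂, h₃]
      simpa [standardWord, triple, List.replicate, Letter.inv] using h₁
  · rw [h.signCount_eq, h.signCount_eq]
    refine h.trans ?_
    rcases a with ⟨_ | _, r⟩
    · have h₁ := isBlock_triple.transport_of_mem (w := [(true, q), (true, q)]) (b := (true, q))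
        (a := (false, r)) (a' := y.inv) (by simp) ha hxy (by simp [Letter.inv, hy])
      have h₂ : signCount false ([(true, q), (true, q)] ++ triple (false, r)) = 3 := rfl
      have h₃ : signCount true ([(true, q), (true, q)] ++ triple (false, r)) = 2 := rfl
      rw [h₂, h₃]
      simpa [standardWord, triple, List.replicate, Letter.inv] using h₁
    · have h₁ := isBlock_triple.transport_of_mem (w := [(true, q), (true, q)]) (b := (true, q))
        (a := (true, r)) (a' := y) (by simp) ha hxy (by simp [hy])
      have h₂ : signCount false ([(true, q), (true, q)] ++ triple (true, r)) = 0 := rfl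
      have h₃ : signCount true ([(true, q), (true, q)] ++ triple (true, r)) = 5 := rfl
      rw [h₂, h₃]
      simpa [standardWord, triple, List.replicate, Letter.inv] using h₁
  -- For `x x x⁻¹` the pair `x x⁻¹` is transported to the point of `a` with the help of `a³`; the
  -- rest without `a³` is then nondegenerate.
  · refine step ([(false, q)] ++ cancelingPair (false, a.2)) a ?_ ?_
    · refine (h.trans (hu.append_right _)).trans ?_
      have h₁ : WordEquiv ([(false, q)] ++ cancelingPair (false, q) ++ triple a)
          ([(false, q)] ++ triple a ++ cancelingPair (false, q)) := by
        simpa using (isBlock_triple.append_comm (cancelingPair (false, q)) a).append_left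
          [(false, q)]
      have h₂ := isBlock_cancelingPair.transport (w := [(false, q)] ++ triple a)
        (not_degenerate_of_mem (a := a) (b := (false, q)) (by simp [triple]) (by simp) ha)
        (a := (false, q)) (a' := (false, a.2)) rfl
      refine (h₁.trans h₂).trans ?_
      simpa using (isBlock_cancelingPair.append_comm (triple a) (false, a.2)).append_left
        [(false, q)]
    · exact not_degenerate_of_mem (a := (false, a.2)) (b := (false, q)) (by simp [cancelingPair])
        (by simp) ha

/-! ### Realizing the model in `GL₂(ℂ)` -/

/-- The embedding of the Eisenstein integers into `ℂ`. -/
noncomputable def eisensteinHom : Eisenstein →+* ℂ where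
  toFun z := z.re + z.im * ((-1 + (Real.sqrt 3 : ℂ) * Complex.I) / 2)
  map_one' := by
    rw [show (1 : Eisenstein).re = 1 from rfl, show (1 : Eisenstein).im = 0 from rfl]; simp
  map_zero' := by simp
  map_add' z w := by simp; ring
  map_mul' z w := by
    have h3 : (Real.sqrt 3 : ℂ) ^ 2 = 3 := by
      rw [← Complex.ofReal_pow, Real.sq_sqrt (by norm_num)]; norm_num
    have hI : Complex.I ^ 2 = -1 := Complex.I_sq
    simp only [QuadraticAlgebra.re_mul, QuadraticAlgebra.im_mul]
    push_cast
    generalize (Real.sqrt 3 : ℂ) = q at h3 ⊢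
    generalize Complex.I = i at hI ⊢
    grind

theorem eisensteinHom_apply (z : Eisenstein) : eisensteinHom z =
    z.re + z.im * ((-1 + (Real.sqrt 3 : ℂ) * Complex.I) / 2) := rfl

theorem eisensteinHom_mk (a b : ℤ) : eisensteinHom ⟨a, b⟩ =
    a + b * ((-1 + (Real.sqrt 3 : ℂ) * Complex.I) / 2) := rfl

theorem eisensteinHom_injective : Function.Injective eisensteinHom := by
  rw [injective_iff_map_eq_zero]
  intro z hz
  rw [eisensteinHom_apply] at hz
  have him := congrArg Complex.im hz
  have hre := congrArg Complex.re hz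
  simp at him hre
  ext
  · simpa [him] using hre
  · simpa using him

/-- A matrix that intertwines the model with the group `G₄`. -/
noncomputable def intertwiningMatrix : Matrix (Fin 2) (Fin 2) ℂ :=
  -- The columns are `ω`-eigenvectors of `t` and `s * t * s`. The second is `s` applied to the
  -- first, scaled by `(√3 + i)/2` so that both generators get Eisenstein entries.
  !![1, ((Real.sqrt 3 : ℂ) + Complex.I) / 2;
    (1 + (Real.sqrt 3 : ℂ)) / 2 * (-1 + Complex.I),
    -(((Real.sqrt 3 : ℂ) + Complex.I) / 2 * ((1 + (Real.sqrt 3 : ℂ)) / 2 * (-1 + Complex.I)))]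

theorem intertwiningMatrix_det_ne_zero : intertwiningMatrix.det ≠ 0 := by
  have h3 : (Real.sqrt 3 : ℂ) ^ 2 = 3 := by
    rw [← Complex.ofReal_pow, Real.sq_sqrt (by norm_num)]; norm_num
  have hI : Complex.I ^ 2 = -1 := Complex.I_sq
  rw [intertwiningMatrix, Matrix.det_fin_two_of]
  generalize (Real.sqrt 3 : ℂ) = q at h3 ⊢
  generalize Complex.I = i at hI ⊢
  grind

/-- The intertwiner of the model with the group `G₄`. -/
noncomputable def intertwiner : GL (Fin 2) ℂ :=
  Matrix.GeneralLinearGroup.mkOfDetNeZero intertwiningMatrix intertwiningMatrix_det_ne_zero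

/-- The embedding of the model into `GL₂(ℂ)`. -/
noncomputable def realize : GL (Fin 2) Eisenstein →* GL (Fin 2) ℂ :=
  (MulAut.conj intertwiner).toMonoidHom.comp (Matrix.GeneralLinearGroup.map eisensteinHom)

theorem realize_injective : Function.Injective realize := by
  refine (MulAut.conj intertwiner).injective.comp ?_
  exact Units.map_injective (Matrix.map_injective eisensteinHom_injective)

theorem realize_eq_iff {g : GL (Fin 2) Eisenstein} {h : GL (Fin 2) ℂ} : realize g = h ↔
    intertwiningMatrix * (g : Matrix (Fin 2) (Fin 2) Eisenstein).map eisensteinHom =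
      h * intertwiningMatrix := by
  have : realize g = intertwiner * Matrix.GeneralLinearGroup.map eisensteinHom g * intertwiner⁻¹ :=
    rfl
  rw [this, mul_inv_eq_iff_eq_mul, ← Units.val_inj]
  rfl

/-- The reflection in `G₄` with a given label. -/
noncomputable def reflection (a : Letter) : GL (Fin 2) ℂ := realize (modelReflection a)

theorem reflection_false_zero : reflection (false, 0) = t := by
  have h3 : (Real.sqrt 3 : ℂ) ^ 2 = 3 := by
    rw [← Complex.ofReal_pow, Real.sq_sqrt (by norm_num)]; norm_num
  have hI : Complex.I ^ 2 = -1 := Complex.I_sq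
  rw [reflection, realize_eq_iff]
  change _ = tMatrix * _
  ext i j
  fin_cases i <;> fin_cases j <;>
    simp [modelReflection, modelMatrix, intertwiningMatrix, tMatrix, Matrix.mul_apply,
      eisensteinHom_mk] <;>
    generalize (Real.sqrt 3 : ℂ) = q at h3 ⊢ <;>
    generalize Complex.I = i at hI ⊢ <;> grind

theorem reflection_false_one : reflection (false, 1) = s * t * s := by
  have h3 : (Real.sqrt 3 : ℂ) ^ 2 = 3 := by
    rw [← Complex.ofReal_pow, Real.sq_sqrt (by norm_num)]; norm_num
  have hI : Complex.I ^ 2 = -1 := Complex.I_sq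
  rw [reflection, realize_eq_iff]
  change _ = (sMatrix * tMatrix * sMatrix) * _
  ext i j
  fin_cases i <;> fin_cases j <;>
    simp [modelReflection, modelMatrix, intertwiningMatrix, tMatrix, sMatrix, Matrix.mul_apply,
      eisensteinHom_mk] <;>
    generalize (Real.sqrt 3 : ℂ) = q at h3 ⊢ <;>
    generalize Complex.I = i at hI ⊢ <;> grind

theorem reflection_injective : Function.Injective reflection :=
  realize_injective.comp modelReflection_injective

theorem reflection_inv (a : Letter) : reflection a.inv = (reflection a)⁻¹ := by
  rw [reflection, modelReflection_inv, map_inv]; rfl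

theorem reflection_conj (a b : Letter) :
    reflection (a.conj b) = (reflection b)⁻¹ * reflection a * reflection b := by
  rw [reflection, modelReflection_conj, map_mul, map_mul, map_inv]; rfl

theorem prod_map_reflection (w : List Letter) : (w.map reflection).prod = realize (wordProd w) := by
  rw [wordProd, map_list_prod, List.map_map]; rfl

theorem reflection_mem (a : Letter) : reflection a ∈ G4 := by
  have h₀ : reflection (false, 0) ∈ G4 :=
    Subgroup.subset_closure (by simp [reflection_false_zero])
  have h₁ : reflection (false, 1) ∈ G4 :=
    Subgroup.subset_closure (by simp [reflection_false_one])
  have hc : ∀ a b : Letter, reflection a ∈ G4 → reflection b ∈ G4 → reflection (a.conj b) ∈ G4 :=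
    fun a b ha hb => by
      rw [reflection_conj]
      exact mul_mem (mul_mem (inv_mem hb) ha) hb
  have h : ∀ p, reflection (false, p) ∈ G4 := by
    intro p
    fin_cases p
    · exact h₀
    · exact h₁
    · exact hc (false, 1) (false, 0) h₁ h₀
    · exact hc (false, 0) (false, 1) h₀ h₁
  rcases a with ⟨_ | _, p⟩
  · exact h p
  · exact (reflection_inv (false, p)) ▸ inv_mem (h p)

theorem G4_eq_closure : G4 = Subgroup.closure {reflection (false, 0), reflection (false, 1)} := by
  rw [G4, reflection_false_zero, reflection_false_one]

/-- Both directions of conjugation are carried together so that the induction over the closure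
passes through inverses. -/
theorem conj_reflection_of_mem {h : GL (Fin 2) ℂ} (hh : h ∈ G4) :
    (∀ a : Letter, ∃ b : Letter, b.1 = a.1 ∧ h * reflection a * h⁻¹ = reflection b) ∧
      ∀ a : Letter, ∃ b : Letter, b.1 = a.1 ∧ h⁻¹ * reflection a * h = reflection b := by
  have gen : ∀ c : Letter,
      (∀ a : Letter, ∃ b : Letter, b.1 = a.1 ∧
        reflection c * reflection a * (reflection c)⁻¹ = reflection b) ∧
      ∀ a : Letter, ∃ b : Letter, b.1 = a.1 ∧
        (reflection c)⁻¹ * reflection a * reflection c = reflection b := fun c =>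
    ⟨fun a => ⟨a.conj c.inv, rfl, by rw [reflection_conj, reflection_inv, inv_inv]⟩,
      fun a => ⟨a.conj c, rfl, (reflection_conj a c).symm⟩⟩
  rw [G4_eq_closure] at hh
  induction hh using Subgroup.closure_induction with
  | mem g hg =>
    rcases hg with rfl | rfl
    · exact gen _
    · exact gen _
  | one => exact ⟨fun a => ⟨a, rfl, by simp⟩, fun a => ⟨a, rfl, by simp⟩⟩
  | mul g k _ _ hg hk =>
    constructor
    · intro a
      obtain ⟨b, hb, e⟩ := hk.1 a
      obtain ⟨c, hc, e'⟩ := hg.1 b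
      exact ⟨c, hc.trans hb, by rw [← e', ← e]; group⟩
    · intro a
      obtain ⟨b, hb, e⟩ := hg.2 a
      obtain ⟨c, hc, e'⟩ := hk.2 b
      exact ⟨c, hc.trans hb, by rw [← e', ← e]; group⟩
  | inv g _ hg =>
    rw [inv_inv]
    exact ⟨hg.2, hg.1⟩

theorem mem_R1_iff {g : GL (Fin 2) ℂ} : g ∈ R1 ↔ ∃ p, g = reflection (false, p) := by
  constructor
  · rintro ⟨h, hh, rfl⟩
    obtain ⟨⟨r, p⟩, hb, e⟩ := (conj_reflection_of_mem hh).1 (false, 0)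
    obtain rfl : r = false := hb
    exact ⟨p, by rw [← e, reflection_false_zero]⟩
  · rintro ⟨p, rfl⟩
    have key : ∀ p, ∃ c : Letter, Letter.conj (false, 0) c = (false, p) := by decide
    obtain ⟨c, hc⟩ := key p
    refine ⟨(reflection c)⁻¹, inv_mem (reflection_mem c), ?_⟩
    rw [← hc, reflection_conj, reflection_false_zero, inv_inv]

theorem mem_R1Inv_iff {g : GL (Fin 2) ℂ} : g ∈ R1Inv ↔ ∃ p, g = reflection (true, p) := by
  have h : ∀ p, (reflection (false, p))⁻¹ = reflection (true, p) :=
    fun p => (reflection_inv (false, p)).symm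
  simp only [R1Inv, Set.mem_ofPred_eq, mem_R1_iff, inv_eq_iff_eq_inv, h]

theorem reflection_mem_R1_iff (a : Letter) : reflection a ∈ R1 ↔ a.1 = false := by
  rw [mem_R1_iff]
  constructor
  · rintro ⟨p, hp⟩
    rw [reflection_injective hp]
  · intro h
    exact ⟨a.2, by rw [← h]⟩

theorem reflection_mem_R1Inv_iff (a : Letter) : reflection a ∈ R1Inv ↔ a.1 = true := by
  rw [mem_R1Inv_iff]
  constructor
  · rintro ⟨p, hp⟩
    rw [reflection_injective hp]
  · intro h
    exact ⟨a.2, by rw [← h]⟩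

/-! ### Elements and reflections of `G₄` -/

/-- The matrices of the elements of the model of `G₄`. -/
def modelElements : List (Matrix (Fin 2) (Fin 2) Eisenstein) :=
  let i := modelMatrix (false, 0) * modelMatrix (true, 1)
  let j := modelMatrix (false, 0) * modelMatrix (true, 2)
  let k := modelMatrix (false, 0) * modelMatrix (true, 3)
  [1, -1, i, -i, j, -j, k, -k] ++ (List.finRange 4).flatMap fun p =>
    [modelMatrix (false, p), modelMatrix (true, p), -modelMatrix (false, p),
      -modelMatrix (true, p)]

/-- The explicit list contains 1 and is stable under right multiplication by all letters. -/
theorem exists_of_mem_G4 {r : GL (Fin 2) ℂ} (hr : r ∈ G4) :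
    ∃ g : GL (Fin 2) Eisenstein, (g : Matrix (Fin 2) (Fin 2) Eisenstein) ∈ modelElements ∧
      realize g = r := by
  have key : ∀ g ∈ modelElements, ∀ a, g * modelMatrix a ∈ modelElements := by decide +kernel
  have step : ∀ (g : GL (Fin 2) Eisenstein) (a : Letter),
      (g : Matrix (Fin 2) (Fin 2) Eisenstein) ∈ modelElements →
      ((g * modelReflection a : GL (Fin 2) Eisenstein) : Matrix (Fin 2) (Fin 2) Eisenstein) ∈
        modelElements := fun g a hg => key _ hg a
  rw [G4_eq_closure] at hr
  induction hr using Subgroup.closure_induction_right with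
  | one => exact ⟨1, by simp [modelElements], map_one _⟩
  | mul_right x y hx hy ih =>
    obtain ⟨g, hg, rfl⟩ := ih
    rcases hy with rfl | rfl
    · exact ⟨_, step g (false, 0) hg, map_mul _ _ _⟩
    · exact ⟨_, step g (false, 1) hg, map_mul _ _ _⟩
  | mul_inv_cancel x y hx hy ih =>
    obtain ⟨g, hg, rfl⟩ := ih
    rcases hy with rfl | rfl
    · rw [← reflection_inv]; exact ⟨_, step g (true, 0) hg, map_mul _ _ _⟩
    · rw [← reflection_inv]; exact ⟨_, step g (true, 1) hg, map_mul _ _ _⟩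

theorem det_sub_one_eq_zero_of_isReflection {r : GL (Fin 2) ℂ}
    (hr : IsReflection (Matrix.toLin' (r : Matrix (Fin 2) (Fin 2) ℂ))) :
    ((r : Matrix (Fin 2) (Fin 2) ℂ) - 1).det = 0 := by
  rw [IsReflection, Module.finrank_fin_fun] at hr
  have hne : Module.End.eigenspace (Matrix.toLin' (r : Matrix (Fin 2) (Fin 2) ℂ)) 1 ≠ ⊥ := by
    intro h
    rw [h, finrank_bot] at hr
    omega
  obtain ⟨v, hv, hv0⟩ := Submodule.exists_mem_ne_zero_of_ne_bot hne
  rw [Module.End.mem_eigenspace_iff, Matrix.toLin'_apply, one_smul] at hv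
  refine Matrix.exists_mulVec_eq_zero_iff.mp ⟨v, hv0, ?_⟩
  rw [Matrix.sub_mulVec, hv, Matrix.one_mulVec, sub_self]

theorem ne_one_of_isReflection {r : GL (Fin 2) ℂ}
    (hr : IsReflection (Matrix.toLin' (r : Matrix (Fin 2) (Fin 2) ℂ))) : r ≠ 1 := by
  rintro rfl
  have h : Module.End.eigenspace
      (Matrix.toLin' ((1 : GL (Fin 2) ℂ) : Matrix (Fin 2) (Fin 2) ℂ)) 1 = ⊤ := by
    ext v
    simp
  rw [IsReflection, h, finrank_top] at hr
  omega

/-- A reflection satisfies `det (r - 1) = 0`. This condition descends to the model, where among the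
listed matrices it selects only 1 and the eight letters. -/
theorem exists_label_of_isReflection {r : GL (Fin 2) ℂ} (hr : r ∈ G4)
    (hr' : IsReflection (Matrix.toLin' (r : Matrix (Fin 2) (Fin 2) ℂ))) :
    ∃ a, reflection a = r := by
  obtain ⟨g, hg, rfl⟩ := exists_of_mem_G4 hr
  have key : ∀ g ∈ modelElements, (g - 1).det = 0 → g = 1 ∨ ∃ a, g = modelMatrix a := by
    decide +kernel
  have hdet : ((g : Matrix (Fin 2) (Fin 2) Eisenstein) - 1).det = 0 := by
    apply eisensteinHom_injective
    have h₁ := realize_eq_iff.mp (rfl : realize g = realize g)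
    have h₂ : intertwiningMatrix * ((g : Matrix (Fin 2) (Fin 2) Eisenstein) - 1).map eisensteinHom =
        ((realize g : Matrix (Fin 2) (Fin 2) ℂ) - 1) * intertwiningMatrix := by
      rw [sub_mul, ← h₁, one_mul, Matrix.map_sub _ (map_sub _), mul_sub,
        Matrix.map_one _ (map_zero _) (map_one _), mul_one]
    have h₃ := congrArg Matrix.det h₂
    rw [Matrix.det_mul, Matrix.det_mul, det_sub_one_eq_zero_of_isReflection hr', zero_mul] at h₃
    rw [RingHom.map_det, map_zero]
    exact (mul_eq_zero.mp h₃).resolve_left intertwiningMatrix_det_ne_zero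
  rcases key _ hg hdet with h | ⟨a, h⟩
  · refine absurd ?_ (ne_one_of_isReflection hr')
    rw [show g = 1 from Units.ext h, map_one]
  · exact ⟨a, congrArg realize (Units.ext h.symm)⟩

/-! ### From words back to tuples -/

theorem WordEquiv.mem_hurwitzOrbit {w w' : List Letter} (h : WordEquiv w w') :
    w'.map reflection ∈ hurwitzOrbit (w.map reflection) := by
  refine Relation.ReflTransGen.lift (List.map reflection) (fun u v huv => ?_) _ _ h
  obtain ⟨l₁, l₂, a, b⟩ := huv
  simpa [Function.onFun, reflection_conj] using
    HurwitzMove.move (l₁.map reflection) (l₂.map reflection) (reflection a) (reflection b)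

theorem map_standardWord (x y : Letter) (n m : ℕ) : (standardWord x y n m).map reflection =
    standardFactorization (reflection x) (reflection y) n m := by
  unfold standardWord standardFactorization
  split_ifs <;> simp [reflection_inv]

theorem classCount_R1 (w : List Letter) : classCount R1 (w.map reflection) = signCount false w := by
  rw [classCount, signCount, List.count, List.countP_map, List.countP_map]
  refine List.countP_congr fun a _ => ?_
  simp [reflection_mem_R1_iff]

theorem classCount_R1Inv (w : List Letter) :
    classCount R1Inv (w.map reflection) = signCount true w := by
  rw [classCount, signCount, List.count, List.countP_map, List.countP_map]
  refine List.countP_congr fun a _ => ?_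
  simp [reflection_mem_R1Inv_iff]

/-- A degenerate word generates a subgroup of a cyclic group, whereas the two generators of `G₄` do
not commute. -/
theorem not_degenerate_of_closure_eq {w : List Letter}
    (h : Subgroup.closure {r | r ∈ w.map reflection} = G4) : ¬ Degenerate w := by
  rintro ⟨p, hp⟩
  have hle : G4 ≤ Subgroup.zpowers (reflection (false, p)) := by
    rw [← h, Subgroup.closure_le]
    intro r hr
    obtain ⟨⟨s, q⟩, ha, rfl⟩ := List.mem_map.mp hr
    obtain rfl : q = p := hp _ ha
    cases s
    · exact Subgroup.mem_zpowers _
    · exact (reflection_inv (false, q)) ▸ inv_mem (Subgroup.mem_zpowers (reflection (false, q)))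
  obtain ⟨i, hi⟩ := Subgroup.mem_zpowers_iff.mp (hle (reflection_mem (false, 0)))
  obtain ⟨j, hj⟩ := Subgroup.mem_zpowers_iff.mp (hle (reflection_mem (false, 1)))
  have hcomm : reflection (false, 0) * reflection (false, 1) =
      reflection (false, 1) * reflection (false, 0) := by
    rw [← hi, ← hj, ← zpow_add, ← zpow_add, add_comm]
  have hne : modelReflection (false, 0) * modelReflection (false, 1) ≠
      modelReflection (false, 1) * modelReflection (false, 0) := by decide +kernel
  exact hne (realize_injective (by simpa [reflection] using hcomm))

end TetrahedralReflection

open TetrahedralReflection in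
theorem mainTheorem9
    (x : GL (Fin 2) ℂ) (hx : x ∈ R1)
    (T : List (GL (Fin 2) ℂ))
    (hT : IsReflectionFactorization T x)
    (hlen : 8 ≤ T.length)
    (hgen : Subgroup.closure {r | r ∈ T} = G4)
    (n m : ℕ) (hn : classCount R1 T = n) (hm : classCount R1Inv T = m) :
    n + 2 * m ≡ 1 [MOD 3] ∧
      (∃ y ∈ R1Inv, y ≠ x⁻¹) ∧
      ∀ y ∈ R1Inv, y ≠ x⁻¹ → standardFactorization x y n m ∈ hurwitzOrbit T := by
  obtain ⟨p, rfl⟩ := mem_R1_iff.mp hx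
  -- Each entry lies in the group generated by the tuple, which is `G₄`, and so carries a label.
  obtain ⟨w, rfl⟩ : T ∈ Set.range (List.map reflection) := by
    rw [Set.range_list_map]
    exact fun r hr => exists_label_of_isReflection
      (hgen ▸ Subgroup.subset_closure hr) (hT.isReflection r hr)
  have hprod : wordProd w = modelReflection (false, p) :=
    realize_injective ((prod_map_reflection w).symm.trans hT.prod_eq)
  have hw := not_degenerate_of_closure_eq hgen
  rw [classCount_R1] at hn
  rw [classCount_R1Inv] at hm
  subst hn hm
  have hxinv : (reflection (false, p))⁻¹ = reflection (true, p) :=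
    (reflection_inv (false, p)).symm
  rw [hxinv]
  refine ⟨signCount_modEq hprod, ?_, ?_⟩
  · obtain ⟨q, hq⟩ := exists_ne p
    exact ⟨reflection (true, q), mem_R1Inv_iff.mpr ⟨q, rfl⟩,
      fun h => hq (congrArg Prod.snd (reflection_injective h))⟩
  · intro y hy hyx
    obtain ⟨q, rfl⟩ := mem_R1Inv_iff.mp hy
    have hqp : q ≠ p := fun h => hyx (by rw [h])
    rw [← map_standardWord]
    exact (equiv_standardWord (y := (true, q)) rfl rfl hqp w hw hprod).mem_hurwitzOrbit
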